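/- Let $n\ge 1$ and let $W$ be the dihedral group of order $2n$, generated by two reflections $s_1,s_2$ in adjacent axes (so $s_1^2=s_2^2=(s_1s_2)^n=1$), with word length $\ell(w)$ in $s_1,s_2$ and longest element $w_0=s_1s_2s_1\cdots$ ($n$ factors). Let $0<\theta\le 1$ and $q=\theta^{-1}$, let $$\pi(w)=\frac{q^{\ell(w)}}{\sum_{v\in W}q^{\ell(v)}},$$ and let $H$ be the Iwahori–Hecke algebra of $W$: the real algebra with basis $(T_w)_{w\in W}$, unit $T_{\mathrm{id}}$, and, with $T_i=T_{s_i}$, $$T_iT_w=T_{s_iw}\ \text{ if }\ell(s_iw)>\ell(w),\qquad T_iT_w=(q-1)T_w+qT_{s_iw}\ \text{ if }\ell(s_iw)<\ell(w).$$ Put $\tilde T_w=q^{-\ell(w)}T_w$ and $\tilde T_i=\tilde T_{s_i}$. Let $K$ be the matrix of left multiplication by $\tilde T_{w_0}^2$ in the basis $(\tilde T_w)$, i.e. $\tilde T_{w_0}^2\tilde T_x=\sum_y K(x,y)\tilde T_y$. For $x\in W$ and an integer $\ell\ge 0$ let $K_x^\ell(y)=K^\ell(x,y)$ and $$\Big\|\frac{K_x^\ell}{\pi}-1\Big\|_2^2=\sum_{y\in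 W}\Big(\frac{K^\ell(x,y)}{\pi(y)}-1\Big)^2\pi(y).$$ Then $\tilde T_{w_0}^2=\tilde T_1\tilde T_2\tilde T_1\cdots$ ($2n$ factors), and $K=K_1K_2K_1K_2\cdots K_2$ ($2n$ factors), where $K_i$ is the Metropolis step with generator $s_i$: from $x$ move to $s_ix$ if $\ell(s_ix)>\ell(x)$; if $\ell(s_ix)<\ell(x)$ move to $s_ix$ with probability $\theta$ and stay at $x$ with probability $1-\theta$. Moreover, for every $\ell\ge 0$ (and with $\frac{\theta^k-1}{\theta-1}$ read as $1+\theta+\cdots+\theta^{k-1}$, which gives it the value $k$ at $\theta=1$), the following hold. (a) For the chain started at the identity $1\in W$, $$\Big\|\frac{K_1^\ell}{\pi}-1\Big\|_2^2=\theta^{(4\ell-1)n}+\theta^{(2\ell-1)n}\Big(\frac{\theta^2-1}{\theta-1}\cdot\frac{\theta^n-1}{\theta-1}-1\Big)-\theta^{2\ell n}.$$ (b) $$\sum_{x\in W}\pi(x)\Big\|\frac{K_x^\ell}{\pi}-1\Big\|_2^2=\theta^{4\ell n}+(2n-2)\theta^{2\ell n}.$$ In particular, if $\theta<1$, then a single scan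 from the identity satisfies $\big\|K_1^1/\pi-1\big\|_2^2\le \dfrac{2\theta^{n+1}}{1-\theta}$ for every $n\ge1$, and so for fixed $\theta$ this squared distance tends to $0$ as $n\to\infty$. -/

import Mathlib

namespace DihedralScan

/-! ### The dihedral group of order `2n`, its two generating reflections and its length function -/

/-- The generators: `gen n 0 = s₁` and `gen n 1 = s₂`, two reflections in adjacent axes. They generate
`DihedralGroup n`, and `s₁² = s₂² = (s₁ s₂)ⁿ = 1`. -/
def gen (n : ℕ) : Fin 2 → DihedralGroup n
  | 0 => DihedralGroup.sr 0
  | 1 => DihedralGroup.sr 1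

/-- The word length of `w` with respect to the generators `s₁, s₂`. -/
noncomputable def length (n : ℕ) (w : DihedralGroup n) : ℕ :=
  sInf {k | ∃ a : List (Fin 2), a.length = k ∧ (a.map (gen n)).prod = w}

/-- The alternating product `a b a b ⋯` with `k` factors. -/
def altProd {M : Type*} [Monoid M] : M → M → ℕ → M
  | _, _, 0 => 1
  | a, b, k + 1 => a * altProd b a k

/-- The longest element `w₀ = s₁ s₂ s₁ ⋯` (`n` factors). -/
def longest (n : ℕ) : DihedralGroup n := altProd (gen n 0) (gen n 1) n

/-! Helper facts: the length is the distance from `1` on the cycle of `2n` chambers. -/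

/-- The position of the chamber of `w` on the cycle of `2n` chambers. -/
def pos (n : ℕ) : DihedralGroup n → ℕ
  | .r i => 2 * i.val
  | .sr j => if j.val = 0 then 2 * n - 1 else 2 * j.val - 1

theorem gen_mul_self (n : ℕ) (i : Fin 2) : gen n i * gen n i = 1 := by
  fin_cases i <;> simp [gen]

theorem gen_mul_cancel_left (n : ℕ) (i : Fin 2) (w : DihedralGroup n) :
    gen n i * (gen n i * w) = w := by
  rw [← mul_assoc, gen_mul_self, one_mul]

theorem mul_gen_cancel_right (n : ℕ) (i : Fin 2) (w : DihedralGroup n) :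
    w * gen n i * gen n i = w := by
  rw [mul_assoc, gen_mul_self, mul_one]

variable {n : ℕ} [NeZero n]

set_option linter.unusedSectionVars false

theorem pos_lt (w : DihedralGroup n) : pos n w < 2 * n := by
  have hn : 0 < n := Nat.pos_of_ne_zero (NeZero.ne n)
  rcases w with i | i <;> have := ZMod.val_lt i <;> simp only [pos]
  · omega
  · split_ifs <;> omega

theorem pos_injective : Function.Injective (pos n) := by
  have hn : 0 < n := Nat.pos_of_ne_zero (NeZero.ne n)
  rintro (i | i) (j | j) h <;> have hi := ZMod.val_lt i <;> have hj := ZMod.val_lt j <;>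
    simp only [pos] at h
  · rw [ZMod.val_injective n (by omega : i.val = j.val)]
  · split_ifs at h <;> omega
  · split_ifs at h <;> omega
  · rw [ZMod.val_injective n (by split_ifs at h <;> omega : i.val = j.val)]

theorem val_neg_cases (i : ZMod n) : (-i).val = if i.val = 0 then 0 else n - i.val := by
  rw [ZMod.neg_val]; simp [ZMod.val_eq_zero]

theorem val_add_one_cases (i : ZMod n) :
    (i + 1).val = if i.val + 1 = n then 0 else i.val + 1 := by
  have hi := ZMod.val_lt i
  have hn : 0 < n := Nat.pos_of_ne_zero (NeZero.ne n)
  rw [ZMod.val_add, ZMod.val_one_eq_one_mod, Nat.add_mod_mod]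
  split_ifs with h
  · rw [h, Nat.mod_self]
  · exact Nat.mod_eq_of_lt (by omega)

theorem val_sub_one_cases (i : ZMod n) :
    (i - 1).val = if i.val = 0 then n - 1 else i.val - 1 := by
  have h := val_add_one_cases (i - 1)
  have h1 := ZMod.val_lt (i - 1)
  have h2 := ZMod.val_lt i
  rw [sub_add_cancel] at h
  split_ifs at h ⊢ <;> omega

/-- Moving one chamber down or up the cycle. -/
def stepPos (n : ℕ) (up : Prop) [Decidable up] (c : ℕ) : ℕ :=
  if up then (if c + 1 = 2 * n then 0 else c + 1) else (if c = 0 then 2 * n - 1 else c - 1)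

theorem pos_gen_mul (i : Fin 2) (w : DihedralGroup n) :
    pos n (gen n i * w) = stepPos n ((pos n w + i.val) % 2 = 1) (pos n w) := by
  have hn : 0 < n := Nat.pos_of_ne_zero (NeZero.ne n)
  rcases w with j | j <;> have hj := ZMod.val_lt j <;> fin_cases i <;>
    simp only [gen, pos, stepPos, DihedralGroup.sr_mul_r, DihedralGroup.sr_mul_sr, zero_add,
      sub_zero, add_comm (1 : ZMod n) j, val_add_one_cases, val_sub_one_cases] <;>
    split_ifs <;> first | omega | (simp_all <;> omega) | grind

theorem pos_mul_gen (i : Fin 2) (w : DihedralGroup n) :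
    pos n (w * gen n i) =
      if stepPos n (i = 0) (pos n w) = 0 then 0 else 2 * n - stepPos n (i = 0) (pos n w) := by
  have hn : 0 < n := Nat.pos_of_ne_zero (NeZero.ne n)
  rcases w with j | j <;> have hj := ZMod.val_lt j <;> fin_cases i <;>
    simp only [gen, pos, stepPos, DihedralGroup.r_mul_sr, DihedralGroup.sr_mul_sr, zero_sub,
      ← neg_sub j 1, val_neg_cases, val_sub_one_cases] <;>
    split_ifs <;> first | omega | (simp_all <;> omega) | grind

/-- The distance from `1` on the cycle of chambers. -/
def cycDist (n : ℕ) (w : DihedralGroup n) : ℕ := min (pos n w) (2 * n - pos n w)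

theorem pos_one : pos n 1 = 0 := by
  rw [DihedralGroup.one_def]
  simp only [pos, ZMod.val_zero, mul_zero]

theorem cycDist_one : cycDist n 1 = 0 := by
  simp [cycDist, pos_one]

theorem cycDist_gen_mul_le (i : Fin 2) (w : DihedralGroup n) :
    cycDist n (gen n i * w) ≤ cycDist n w + 1 := by
  have h := pos_lt w
  simp only [cycDist, pos_gen_mul, stepPos]
  split_ifs <;> omega

theorem stepPos_spec (up : Prop) [Decidable up] {c : ℕ} (hc : c < 2 * n) :
    stepPos n up c < 2 * n ∧
      ((up ∧ (stepPos n up c = c + 1 ∨ c + 1 = 2 * n ∧ stepPos n up c = 0)) ∨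
        (¬ up ∧ (stepPos n up c + 1 = c ∨ c = 0 ∧ stepPos n up c + 1 = 2 * n))) := by
  unfold stepPos
  by_cases h : up
  · simp only [h, if_true, true_and, not_true, false_and, or_false]
    split_ifs <;> omega
  · simp only [h, if_false, false_and, not_false_iff, true_and, false_or]
    split_ifs <;> omega

theorem cycDist_mul_gen (i : Fin 2) (w : DihedralGroup n) :
    cycDist n (w * gen n i) =
      min (stepPos n (i = 0) (pos n w)) (2 * n - stepPos n (i = 0) (pos n w)) := by
  have h := (stepPos_spec (i = 0) (pos_lt w)).1
  simp only [cycDist, pos_mul_gen]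
  generalize stepPos n (i = 0) (pos n w) = t at *
  split_ifs <;> omega

theorem exists_cycDist_gen_mul (w : DihedralGroup n) (hw : w ≠ 1) :
    ∃ i, cycDist n (gen n i * w) + 1 = cycDist n w := by
  have h := pos_lt w
  have h0 : pos n w ≠ 0 := fun h0 => hw (pos_injective (h0.trans pos_one.symm))
  by_contra! hc
  have h1 := hc 0
  have h2 := hc 1
  simp only [cycDist, pos_gen_mul, stepPos, Fin.val_zero, Fin.val_one] at h1 h2
  split_ifs at h1 h2 <;> omega

theorem exists_cycDist_mul_gen (w : DihedralGroup n) (hw : w ≠ 1) :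
    ∃ i, cycDist n (w * gen n i) + 1 = cycDist n w := by
  have h := pos_lt w
  have h0 : pos n w ≠ 0 := fun h0 => hw (pos_injective (h0.trans pos_one.symm))
  by_contra! hc
  have h1 := hc 0
  have h2 := hc 1
  simp only [cycDist_mul_gen, stepPos] at h1 h2
  simp at h1 h2
  simp only [cycDist] at h1 h2
  split_ifs at h1 h2 <;> omega

theorem length_eq_cycDist (w : DihedralGroup n) : length n w = cycDist n w := by
  have lower : ∀ a : List (Fin 2), cycDist n (a.map (gen n)).prod ≤ a.length := by
    intro a
    induction a with
    | nil => simp [cycDist_one]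
    | cons i a ih =>
      have := cycDist_gen_mul_le i (a.map (gen n)).prod
      simp only [List.map_cons, List.prod_cons, List.length_cons]
      omega
  have upper : ∀ k, ∀ w : DihedralGroup n, cycDist n w = k →
      ∃ a : List (Fin 2), a.length = k ∧ (a.map (gen n)).prod = w := by
    intro k
    induction k with
    | zero =>
      intro w hw
      refine ⟨[], rfl, ?_⟩
      by_contra hne
      obtain ⟨i, hi⟩ := exists_cycDist_gen_mul w (fun h => hne (by simp [h]))
      omega
    | succ k ih =>
      intro w hw
      have hne : w ≠ 1 := by
        rintro rfl
        simp [cycDist_one] at hw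
      obtain ⟨i, hi⟩ := exists_cycDist_gen_mul w hne
      obtain ⟨a, ha, hp⟩ := ih (gen n i * w) (by omega)
      exact ⟨i :: a, by simp [ha], by simp [hp, gen_mul_cancel_left]⟩
  apply le_antisymm
  · exact Nat.sInf_le (upper _ w rfl)
  · refine le_csInf ⟨_, upper _ w rfl⟩ ?_
    rintro k ⟨a, rfl, rfl⟩
    exact lower a

theorem length_one : length n 1 = 0 := by rw [length_eq_cycDist, cycDist_one]

theorem length_gen_mul_ne (i : Fin 2) (w : DihedralGroup n) :
    length n (gen n i * w) ≠ length n w := by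
  have h := pos_lt w
  simp only [length_eq_cycDist, cycDist, pos_gen_mul, stepPos]
  split_ifs <;> omega

theorem length_mul_gen_ne (i : Fin 2) (w : DihedralGroup n) :
    length n (w * gen n i) ≠ length n w := by
  have h := pos_lt w
  have h1 := stepPos_spec (i = 0) h
  simp only [length_eq_cycDist, cycDist_mul_gen]
  simp only [cycDist]
  generalize stepPos n (i = 0) (pos n w) = t at *
  omega

theorem length_gen_mul_lt_iff (i : Fin 2) (w : DihedralGroup n) :
    length n (gen n i * w) < length n w ↔
      if (pos n w + i.val) % 2 = 1 then n ≤ pos n w else 1 ≤ pos n w ∧ pos n w ≤ n := by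
  have hc := pos_lt w
  have p := stepPos_spec ((pos n w + i.val) % 2 = 1) hc
  simp only [length_eq_cycDist, cycDist, pos_gen_mul]
  generalize stepPos n ((pos n w + i.val) % 2 = 1) (pos n w) = a at *
  generalize pos n w = c at *
  split_ifs with h <;> simp only [h, true_and, not_true_eq_false, not_false_eq_true,
    false_and, or_false, false_or] at p <;> omega

/-- If `s w ≠ w t`, then `s` lengthens `w` if and only if it lengthens `w t`. -/
theorem lt_left_iff (i j : Fin 2) (w : DihedralGroup n) (h : gen n i * w ≠ w * gen n j) :
    length n (gen n i * (w * gen n j)) < length n (w * gen n j) ↔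
      length n (gen n i * w) < length n w := by
  have hc := pos_lt w
  have h' : pos n (gen n i * w) ≠ pos n (w * gen n j) := fun e => h (pos_injective e)
  have p1 := stepPos_spec ((pos n w + i.val) % 2 = 1) hc
  have p2 := stepPos_spec (j = 0) hc
  have e2 := pos_mul_gen j w
  rw [← pos_gen_mul] at p1
  rw [length_gen_mul_lt_iff, length_gen_mul_lt_iff]
  generalize stepPos n (j = 0) (pos n w) = t at *
  generalize pos n (w * gen n j) = u at *
  generalize pos n (gen n i * w) = a at *
  generalize pos n w = c at *
  have hi : i.val = 0 ∨ i.val = 1 := by omega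
  generalize i.val = i' at *
  by_cases q : (c + i') % 2 = 1
  · have q' : ¬ (u + i') % 2 = 1 := by
      rcases p2.2 with ⟨-, p2 | p2⟩ | ⟨-, p2 | p2⟩ <;> split_ifs at e2 <;> omega
    simp only [q, q', if_true, if_false, true_and, not_true, false_and, or_false] at p1 ⊢
    rcases p2.2 with ⟨-, p2 | p2⟩ | ⟨-, p2 | p2⟩ <;> split_ifs at e2 <;> omega
  · have q' : (u + i') % 2 = 1 := by
      rcases p2.2 with ⟨-, p2 | p2⟩ | ⟨-, p2 | p2⟩ <;> split_ifs at e2 <;> omega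
    simp only [q, q', if_true, if_false, true_and, not_false_iff, false_and, false_or] at p1 ⊢
    rcases p2.2 with ⟨-, p2 | p2⟩ | ⟨-, p2 | p2⟩ <;> split_ifs at e2 <;> omega

theorem length_mul_gen_le (i : Fin 2) (w : DihedralGroup n) :
    length n (w * gen n i) ≤ length n w + 1 := by
  have h := pos_lt w
  have h1 := stepPos_spec (i = 0) h
  simp only [length_eq_cycDist, cycDist_mul_gen]
  simp only [cycDist]
  generalize stepPos n (i = 0) (pos n w) = t at *
  omega

theorem length_gen_mul_le (i : Fin 2) (w : DihedralGroup n) :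
    length n (gen n i * w) ≤ length n w + 1 := by
  simpa only [length_eq_cycDist] using cycDist_gen_mul_le i w

/-- If `s w ≠ w t`, then `t` lengthens `w` if and only if it lengthens `s w`. -/
theorem lt_right_iff (i j : Fin 2) (w : DihedralGroup n) (h : gen n i * w ≠ w * gen n j) :
    length n (gen n i * (w * gen n j)) < length n (gen n i * w) ↔
      length n (w * gen n j) < length n w := by
  have h0 := lt_left_iff i j w h
  have a1 := length_gen_mul_le i w
  have a2 := length_gen_mul_le i (gen n i * w)
  have a3 := length_mul_gen_le j w
  have a4 := length_mul_gen_le j (w * gen n j)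
  have a5 := length_gen_mul_le i (w * gen n j)
  have a6 := length_gen_mul_le i (gen n i * (w * gen n j))
  have n1 := length_gen_mul_ne i w
  have n3 := length_mul_gen_ne j w
  have n5 := length_gen_mul_ne i (w * gen n j)
  simp only [gen_mul_cancel_left, mul_gen_cancel_right] at a2 a4 a6
  omega

/-! ### The Iwahori–Hecke algebra -/

/-- The operator "left multiplication by `T_i`" on the real vector space with basis `(T_w)`, in
coordinates (`f` stands for `∑ f(w) T_w`): it sends `T_w` to `T_{s_i w}` if `ℓ(s_i w) > ℓ(w)`, and to
`(q - 1) T_w + q T_{s_i w}` if `ℓ(s_i w) < ℓ(w)`; see `leftOp_single`. -/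
noncomputable def leftOp (n : ℕ) (q : ℝ) (i : Fin 2) : Module.End ℝ (DihedralGroup n → ℝ) where
  toFun f y :=
    if length n (gen n i * y) < length n y then f (gen n i * y) + (q - 1) * f y
    else q * f (gen n i * y)
  map_add' f g := by
    ext y; simp only [Pi.add_apply]; split_ifs <;> ring
  map_smul' c f := by
    ext y; simp only [Pi.smul_apply, smul_eq_mul, RingHom.id_apply]; split_ifs <;> ring

/-- The same operator for multiplication by `T_i` on the right. -/
noncomputable def rightOp (n : ℕ) (q : ℝ) (i : Fin 2) : Module.End ℝ (DihedralGroup n → ℝ) where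
  toFun f y :=
    if length n (y * gen n i) < length n y then f (y * gen n i) + (q - 1) * f y
    else q * f (y * gen n i)
  map_add' f g := by
    ext y; simp only [Pi.add_apply]; split_ifs <;> ring
  map_smul' c f := by
    ext y; simp only [Pi.smul_apply, smul_eq_mul, RingHom.id_apply]; split_ifs <;> ring

theorem leftOp_rightOp (q : ℝ) (i j : Fin 2) :
    leftOp n q i * rightOp n q j = rightOp n q j * leftOp n q i := by
  refine LinearMap.ext fun f => funext fun y => ?_
  simp only [Module.End.mul_apply, leftOp, rightOp, LinearMap.coe_mk, AddHom.coe_mk, mul_assoc]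
  by_cases h : gen n i * y = y * gen n j
  · simp only [← h, gen_mul_cancel_left]
  · have h1 := lt_left_iff i j y h
    have h2 := lt_right_iff i j y h
    simp only [h1, h2]
    split_ifs <;> ring

theorem leftOp_single (q : ℝ) (i : Fin 2) (w : DihedralGroup n) :
    leftOp n q i (Pi.single w 1) =
      if length n w < length n (gen n i * w) then Pi.single (gen n i * w) 1
      else (q - 1) • Pi.single w 1 + q • Pi.single (gen n i * w) (1 : ℝ) := by
  ext y
  have hne := length_gen_mul_ne i w
  have e1 : (gen n i * y = w) ↔ (y = gen n i * w) :=
    ⟨fun h => by rw [← h, gen_mul_cancel_left], fun h => by rw [h, gen_mul_cancel_left]⟩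
  have hne' : y = w → y ≠ gen n i * w := by
    rintro rfl h
    rw [← h] at hne
    exact hne rfl
  by_cases h1 : y = gen n i * w
  · subst h1
    have h2 : gen n i * w ≠ w := fun h => hne' h rfl
    simp only [leftOp, LinearMap.coe_mk, AddHom.coe_mk, gen_mul_cancel_left, Pi.single_apply]
    split_ifs <;> simp_all
  · have h2 : gen n i * y ≠ w := fun h => h1 (e1.1 h)
    by_cases h3 : y = w
    · subst h3
      simp only [leftOp, LinearMap.coe_mk, AddHom.coe_mk, Pi.single_apply]
      split_ifs <;> simp_all
      all_goals omega
    · simp only [leftOp, LinearMap.coe_mk, AddHom.coe_mk, Pi.single_apply]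
      split_ifs <;> simp_all

theorem rightOp_single (q : ℝ) (i : Fin 2) (w : DihedralGroup n)
    (h : length n w < length n (w * gen n i)) :
    rightOp n q i (Pi.single w 1) = Pi.single (w * gen n i) 1 := by
  ext y
  have e1 : (y * gen n i = w) ↔ (y = w * gen n i) :=
    ⟨fun h => by rw [← h, mul_gen_cancel_right], fun h => by rw [h, mul_gen_cancel_right]⟩
  by_cases h1 : y = w * gen n i
  · subst h1
    have h2 : w * gen n i ≠ w := fun h' => by rw [h'] at h; exact lt_irrefl _ h
    simp [rightOp, mul_gen_cancel_right, h, h2]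
  · have h2 : y * gen n i ≠ w := fun h => h1 (e1.1 h)
    by_cases h3 : y = w
    · subst h3
      simp [rightOp, h1, h2, h.le]
    · simp [rightOp, h1, h2, h3]

/-- The Iwahori–Hecke algebra `H` of the dihedral group with parameter `q`, realized as the algebra
of operators generated by left multiplication by `T_1` and `T_2`. By `heckeT`, `heckeT_one` and
`heckeT_gen_mul` below it is the algebra with basis `(T_w)`, unit `T_1` (for the identity of the
group) and the multiplication rule `T_i T_w = T_{s_i w}` if `ℓ(s_i w) > ℓ(w)`,
`T_i T_w = (q - 1) T_w + q T_{s_i w}` if `ℓ(s_i w) < ℓ(w)`. -/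
noncomputable abbrev Hecke (n : ℕ) (q : ℝ) : Subalgebra ℝ (Module.End ℝ (DihedralGroup n → ℝ)) :=
  Algebra.adjoin ℝ (Set.range (leftOp n q))

/-- The coordinates of an element `h` of `H` in the basis `(T_w)`: apply `h` to `T_1`. -/
noncomputable def heckeCoord (n : ℕ) (q : ℝ) : Hecke n q →ₗ[ℝ] (DihedralGroup n → ℝ) where
  toFun h := h.1 (Pi.single 1 1)
  map_add' _ _ := rfl
  map_smul' _ _ := rfl

theorem hecke_rightOp (q : ℝ) (h : Hecke n q) (j : Fin 2) :
    h.1 * rightOp n q j = rightOp n q j * h.1 := by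
  have hle : Hecke n q ≤ Subalgebra.centralizer ℝ {rightOp n q j} := by
    refine Algebra.adjoin_le ?_
    rintro _ ⟨i, rfl⟩
    rw [SetLike.mem_coe, Subalgebra.mem_centralizer_iff]
    rintro _ rfl
    exact (leftOp_rightOp q i j).symm
  have := hle h.2
  rw [Subalgebra.mem_centralizer_iff] at this
  exact (this _ rfl).symm

theorem heckeCoord_injective (q : ℝ) : Function.Injective (heckeCoord n q) := by
  refine (injective_iff_map_eq_zero _).2 fun h hh => ?_
  have key : ∀ k, ∀ w : DihedralGroup n, length n w = k → h.1 (Pi.single w 1) = 0 := by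
    intro k
    induction k with
    | zero =>
      intro w hw
      have : w = 1 := by
        by_contra hne
        obtain ⟨i, hi⟩ := exists_cycDist_mul_gen w hne
        rw [length_eq_cycDist] at hw
        omega
      rw [this]
      exact hh
    | succ k ih =>
      intro w hw
      have hne : w ≠ 1 := by
        rintro rfl
        simp [length_one] at hw
      obtain ⟨i, hi⟩ := exists_cycDist_mul_gen w hne
      rw [← length_eq_cycDist, ← length_eq_cycDist] at hi
      have e := rightOp_single q i (w * gen n i) (by rw [mul_gen_cancel_right]; omega)
      rw [mul_gen_cancel_right] at e
      rw [← e, ← Module.End.mul_apply, hecke_rightOp, Module.End.mul_apply,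
        ih _ (by omega), map_zero]
  apply Subtype.ext
  refine LinearMap.pi_ext' fun w => LinearMap.ext_ring ?_
  simpa using key _ w rfl

theorem heckeCoord_surjective (q : ℝ) : Function.Surjective (heckeCoord n q) := by
  have key : ∀ k, ∀ w : DihedralGroup n, length n w = k →
      ∃ h : Hecke n q, heckeCoord n q h = Pi.single w 1 := by
    intro k
    induction k with
    | zero =>
      intro w hw
      have : w = 1 := by
        by_contra hne
        obtain ⟨i, hi⟩ := exists_cycDist_mul_gen w hne
        rw [length_eq_cycDist] at hw
        omega
      exact ⟨1, by rw [this]; rfl⟩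
    | succ k ih =>
      intro w hw
      have hne : w ≠ 1 := by
        rintro rfl
        simp [length_one] at hw
      obtain ⟨i, hi⟩ := exists_cycDist_gen_mul w hne
      rw [← length_eq_cycDist, ← length_eq_cycDist] at hi
      obtain ⟨h, hh⟩ := ih (gen n i * w) (by omega)
      refine ⟨⟨leftOp n q i, Algebra.subset_adjoin ⟨i, rfl⟩⟩ * h, ?_⟩
      change leftOp n q i (heckeCoord n q h) = _
      rw [hh, leftOp_single, gen_mul_cancel_left, if_pos (by omega)]
  intro f
  choose g hg using fun w : DihedralGroup n => key _ w rfl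
  refine ⟨∑ w, f w • g w, ?_⟩
  simp only [map_sum, map_smul, hg]
  ext y
  simp [Finset.sum_apply, Pi.single_apply]

/-- The basis `(T_w)` of the Iwahori–Hecke algebra. -/
noncomputable def heckeT (n : ℕ) [NeZero n] (q : ℝ) :
    Module.Basis (DihedralGroup n) ℝ (Hecke n q) :=
  .ofEquivFun (.ofBijective (heckeCoord n q) ⟨heckeCoord_injective q, heckeCoord_surjective q⟩)

theorem heckeCoord_heckeT (q : ℝ) (w : DihedralGroup n) :
    heckeCoord n q (heckeT n q w) = Pi.single w 1 := by
  have h := (heckeT n q).equivFun_self w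
  have h2 : (heckeT n q).equivFun (heckeT n q w) = heckeCoord n q (heckeT n q w) := by
    rw [heckeT, Module.Basis.equivFun_ofEquivFun]; rfl
  rw [← h2]
  ext y
  rw [h, Pi.single_apply]
  simp only [eq_comm]

theorem heckeT_one (q : ℝ) : heckeT n q 1 = 1 :=
  heckeCoord_injective q (by rw [heckeCoord_heckeT]; rfl)

theorem heckeT_gen (q : ℝ) (i : Fin 2) : (heckeT n q (gen n i)).1 = leftOp n q i := by
  have h : heckeT n q (gen n i) =
      (⟨leftOp n q i, Algebra.subset_adjoin ⟨i, rfl⟩⟩ : Hecke n q) := by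
    apply heckeCoord_injective q
    rw [heckeCoord_heckeT]
    change _ = leftOp n q i (Pi.single 1 1)
    have := length_gen_mul_ne i (1 : DihedralGroup n)
    rw [leftOp_single, if_pos (by rw [length_one] at *; omega), mul_one]
  rw [h]

/-- The multiplication rule of the Iwahori–Hecke algebra. -/
theorem heckeT_gen_mul (q : ℝ) (i : Fin 2) (w : DihedralGroup n) :
    heckeT n q (gen n i) * heckeT n q w =
      if length n w < length n (gen n i * w) then heckeT n q (gen n i * w)
      else (q - 1) • heckeT n q w + q • heckeT n q (gen n i * w) := by
  apply heckeCoord_injective q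
  have h : heckeCoord n q (heckeT n q (gen n i) * heckeT n q w) =
      (heckeT n q (gen n i)).1 (heckeCoord n q (heckeT n q w)) := rfl
  rw [h, heckeT_gen, heckeCoord_heckeT, leftOp_single, apply_ite (heckeCoord n q)]
  simp only [map_add, map_smul, heckeCoord_heckeT]

/-- The rescaled basis `T̃_w = q^{-ℓ(w)} T_w` of `H`, where `q = θ⁻¹`. -/
noncomputable def heckeTtilde (n : ℕ) [NeZero n] (θ : ℝ) (hθ : 0 < θ) :
    Module.Basis (DihedralGroup n) ℝ (Hecke n θ⁻¹) :=
  (heckeT n θ⁻¹).isUnitSMul (w := fun v => ((θ⁻¹) ^ length n v)⁻¹) fun _ =>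
    (inv_ne_zero (pow_ne_zero _ (inv_ne_zero hθ.ne'))).isUnit

/-! ### The Markov chains -/

/-- The matrix of left multiplication by `h ∈ H` in the basis `(T̃_w)`, with rows indexed by the
argument: `h T̃_x = ∑_y K(x, y) T̃_y`. -/
noncomputable def leftMulMatrix (n : ℕ) [NeZero n] (θ : ℝ) (hθ : 0 < θ) (h : Hecke n θ⁻¹) :
    Matrix (DihedralGroup n) (DihedralGroup n) ℝ :=
  Matrix.of fun x y => (heckeTtilde n θ hθ).repr (h * heckeTtilde n θ hθ x) y

/-- The systematic scan Metropolis chain: multiplication by `T̃_{w₀}²`. -/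
noncomputable def scan (n : ℕ) [NeZero n] (θ : ℝ) (hθ : 0 < θ) :
    Matrix (DihedralGroup n) (DihedralGroup n) ℝ :=
  leftMulMatrix n θ hθ (heckeTtilde n θ hθ (longest n) ^ 2)

/-- One Metropolis step with generator `s_i`: from `x`, move to `s_i x` if this is longer; if it is
shorter, move to it with probability `θ` and stay at `x` with probability `1 - θ`. -/
noncomputable def metropolis (n : ℕ) (θ : ℝ) (i : Fin 2) :
    Matrix (DihedralGroup n) (DihedralGroup n) ℝ :=
  Matrix.of fun x y =>
    if length n x < length n (gen n i * x) then (if y = gen n i * x then 1 else 0)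
    else (if y = gen n i * x then θ else if y = x then 1 - θ else 0)

/-- The stationary distribution `π(w) = q^{ℓ(w)} / ∑_v q^{ℓ(v)}`, `q = θ⁻¹`. -/
noncomputable def stat (n : ℕ) [NeZero n] (θ : ℝ) (w : DihedralGroup n) : ℝ :=
  (θ⁻¹) ^ length n w / ∑ v, (θ⁻¹) ^ length n v

/-- The squared distance `‖K_x^ℓ/π - 1‖₂²` in `L²(π)`, where `K_x^ℓ(y) = K^ℓ(x, y)`. -/
noncomputable def distSq (n : ℕ) [NeZero n] (θ : ℝ)
    (K : Matrix (DihedralGroup n) (DihedralGroup n) ℝ) (l : ℕ) (x : DihedralGroup n) : ℝ :=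
  ∑ y, ((K ^ l) x y / stat n θ y - 1) ^ 2 * stat n θ y

end DihedralScan

/-! Write P = Σ θ^ℓ(w), S = Σ θ^(n-ℓ(w)) T̃_w and A = Σ (-1)^ℓ(w) T̃_w. Every T̃_i acts on S as 1
and on A as -θ, so S and A span one-dimensional left ideals. Everything rests on the identity
(`heckeTtilde_longest_sq_eq`) T̃_{w₀}² = θⁿ·1 + ((1-θⁿ)/P)·S + ((θ²ⁿ-θⁿ)/P)·A. It comes from
multiplying T̃_{w₀} by one generator at a time: each generator shortens the leading element by a
letter, and the remaining coefficients obey a linear recurrence with an explicit solution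
(`partialCoeff_succ`).

T̃_{w₀}² is central, since it equals both alternating words of length 2n. Hence row x of K can be
read off T̃_x T̃_{w₀}², where S and A absorb T̃_x. This gives K = θⁿ·1 + (1-θⁿ)E + (θ²ⁿ-θⁿ)F with E,
F orthogonal idempotents of rank one: the eigenvalues are 1 and θ²ⁿ, once each, and θⁿ with
multiplicity 2n-2. Powers of K are then explicit, and `distSq_scan` evaluates the squared distance
from every starting point x. Part (a) is x = 1, part (b) is the average over π, and the single-scan
bound discards nonpositive terms from the exact value. -/

namespace DihedralScan

/-! ### Alternating products in a monoid -/

section AltProd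

variable {M : Type*} [Monoid M]

theorem altProd_two_mul (a b : M) (m : ℕ) : altProd a b (2 * m) = (a * b) ^ m := by
  induction m with
  | zero => rw [mul_zero, pow_zero, altProd]
  | succ m ih =>
    rw [show 2 * (m + 1) = 2 * m + 1 + 1 by ring, altProd, altProd, ih, pow_succ', mul_assoc]

theorem altProd_add (a b : M) (m k : ℕ) :
    altProd a b (m + k) = altProd a b m * (if Even m then altProd a b k else altProd b a k) := by
  induction m generalizing a b with
  | zero => simp [altProd]
  | succ m ih =>
    rw [show m + 1 + k = m + k + 1 by ring, altProd, altProd, ih, mul_assoc]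
    by_cases h : Even m <;> simp [h, Nat.even_add_one]

/-- When m is odd the second factor should start with `b`; the braid relation `h` makes this
irrelevant. -/
theorem altProd_mul_self {a b : M} {m : ℕ} (h : altProd a b m = altProd b a m) :
    altProd a b m * altProd a b m = altProd a b (2 * m) := by
  rw [two_mul, altProd_add, ← h, ite_self]

end AltProd

variable {n : ℕ} [NeZero n]

/-! ### Alternating words as positions on the cycle of chambers -/

/-- The last letter of the word fixes the direction of travel around the cycle: upwards from 0 if it
is `gen n 1`, downwards if it is `gen n 0`. The parity of `m + i` records which one it is. -/
theorem pos_altProd (m : ℕ) (hm : m ≤ n) (i j : Fin 2) (hij : i ≠ j) :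
    pos n (altProd (gen n i) (gen n j) m) =
      if m = 0 then 0 else if (m + i.val) % 2 = 0 then m else 2 * n - m := by
  have hn : 0 < n := Nat.pos_of_ne_zero (NeZero.ne n)
  induction m generalizing i j with
  | zero => simp [altProd, pos_one]
  | succ m ih =>
    have hv : i.val + j.val = 1 := by omega
    rw [altProd, pos_gen_mul, ih (by omega) j i hij.symm]
    have hs : ∀ c < 2 * n, c = (if m = 0 then 0 else if (m + j.val) % 2 = 0 then m else 2 * n - m) →
        stepPos n ((c + i.val) % 2 = 1) c =
          if m + 1 = 0 then 0 else if (m + 1 + i.val) % 2 = 0 then m + 1 else 2 * n - (m + 1) := by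
      intro c hc h
      simp only [stepPos]
      split_ifs at h ⊢ <;> first | omega | contradiction
    exact hs _ (by split_ifs <;> omega) rfl

theorem length_altProd (m : ℕ) (hm : m ≤ n) (i j : Fin 2) (hij : i ≠ j) :
    length n (altProd (gen n i) (gen n j) m) = m := by
  rw [length_eq_cycDist, cycDist, pos_altProd m hm i j hij]
  split_ifs <;> omega

theorem pos_longest : pos n (longest n) = n := by
  have hn := NeZero.ne n
  rw [longest, pos_altProd n le_rfl 0 1 (by decide)]
  split_ifs <;> omega

/-- The braid relation: both directions of travel meet at the antipode, position n. -/
theorem altProd_gen_eq_longest (i j : Fin 2) (hij : i ≠ j) :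
    altProd (gen n i) (gen n j) n = longest n := by
  have hn := NeZero.ne n
  apply pos_injective
  rw [pos_longest, pos_altProd n le_rfl i j hij]
  split_ifs <;> omega

/-! ### Sums over the length and the stationary distribution -/

theorem length_le (w : DihedralGroup n) : length n w ≤ n := by
  rw [length_eq_cycDist, cycDist]; omega

/-- Summing a function of the length over the dihedral group. -/
theorem sum_length (g : ℕ → ℝ) :
    ∑ w : DihedralGroup n, g (length n w) = ∑ k ∈ Finset.range n, (g k + g (k + 1)) := by
  have himg : Finset.univ.image (pos n) = Finset.range (2 * n) := by
    apply Finset.eq_of_subset_of_card_le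
    · intro c hc
      obtain ⟨w, -, rfl⟩ := Finset.mem_image.1 hc
      exact Finset.mem_range.2 (pos_lt w)
    · rw [Finset.card_image_of_injective _ pos_injective, Finset.card_univ, Finset.card_range,
        DihedralGroup.card]
  have h1 : ∑ w : DihedralGroup n, g (length n w) =
      ∑ c ∈ Finset.range (2 * n), g (min c (2 * n - c)) := by
    rw [← himg, Finset.sum_image fun _ _ _ _ h => pos_injective h]
    exact Finset.sum_congr rfl fun w _ => by rw [length_eq_cycDist, cycDist]
  -- The half-cycle of positions below n has lengths 0, …, n-1; the other half has lengths n, …, 1,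
  -- which reflection turns into k + 1.
  rw [h1, two_mul, Finset.sum_range_add, Finset.sum_add_distrib]
  congr 1
  · refine Finset.sum_congr rfl fun c hc => ?_
    have := Finset.mem_range.1 hc
    rw [min_eq_left (by omega)]
  · rw [← Finset.sum_range_reflect]
    refine Finset.sum_congr rfl fun c hc => ?_
    have := Finset.mem_range.1 hc
    congr 1
    omega

theorem sum_pow_length (θ : ℝ) :
    ∑ w : DihedralGroup n, θ ^ length n w =
      (∑ i ∈ Finset.range 2, θ ^ i) * ∑ i ∈ Finset.range n, θ ^ i := by
  rw [sum_length fun k => θ ^ k, Finset.mul_sum]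
  refine Finset.sum_congr rfl fun k _ => ?_
  rw [Finset.sum_range_succ, Finset.sum_range_one]
  ring

theorem sum_neg_one_pow_length : ∑ w : DihedralGroup n, (-1 : ℝ) ^ length n w = 0 := by
  rw [sum_pow_length, Finset.sum_range_succ, Finset.sum_range_one]
  norm_num

theorem sum_pow_sub_length (θ : ℝ) :
    ∑ w : DihedralGroup n, θ ^ (n - length n w) = ∑ w : DihedralGroup n, θ ^ length n w := by
  rw [sum_length fun k => θ ^ (n - k), sum_length fun k => θ ^ k, ← Finset.sum_range_reflect]
  refine Finset.sum_congr rfl fun k hk => ?_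
  have := Finset.mem_range.1 hk
  rw [add_comm, show n - (n - 1 - k + 1) = k by omega, show n - (n - 1 - k) = k + 1 by omega]

theorem sum_pow_length_pos {θ : ℝ} (hθ : 0 < θ) : 0 < ∑ w : DihedralGroup n, θ ^ length n w :=
  Finset.sum_pos (fun _ _ => pow_pos hθ _) Finset.univ_nonempty

theorem one_sub_mul_sum_pow_length (θ : ℝ) :
    (1 - θ) * ∑ w : DihedralGroup n, θ ^ length n w = (1 + θ) * (1 - θ ^ n) := by
  rw [sum_pow_length, Finset.sum_range_succ, Finset.sum_range_one]
  linear_combination (-(1 + θ)) * geom_sum_mul θ n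

/-- Numerator and denominator are multiplied by θⁿ; the reversal ℓ ↦ n - ℓ then turns the
normalising sum into P. -/
theorem stat_eq {θ : ℝ} (hθ : 0 < θ) (w : DihedralGroup n) :
    stat n θ w = θ ^ (n - length n w) / ∑ v : DihedralGroup n, θ ^ length n v := by
  have h : ∀ v : DihedralGroup n, (θ⁻¹) ^ length n v = θ ^ (n - length n v) / θ ^ n := by
    intro v
    rw [pow_sub₀ _ hθ.ne' (length_le v), inv_pow]
    have := (pow_pos hθ n).ne'
    field_simp
  rw [stat]
  simp only [h]
  rw [← Finset.sum_div, sum_pow_sub_length, div_div_div_cancel_right₀ (pow_pos hθ n).ne']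

/-- Induction on the length, by left multiplication by generators. -/
theorem length_induction {p : DihedralGroup n → Prop} (one : p 1)
    (step : ∀ i w, length n w < length n (gen n i * w) → p w → p (gen n i * w)) (w) : p w := by
  induction hk : length n w generalizing w with
  | zero =>
    have : w = 1 := by
      by_contra hne
      obtain ⟨i, hi⟩ := exists_cycDist_gen_mul w hne
      rw [length_eq_cycDist] at hk
      omega
    rwa [this]
  | succ k ih =>
    have hne : w ≠ 1 := by
      rintro rfl
      simp [length_one] at hk
    obtain ⟨i, hi⟩ := exists_cycDist_gen_mul w hne
    rw [← length_eq_cycDist, ← length_eq_cycDist] at hi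
    have := step i (gen n i * w) (by rw [gen_mul_cancel_left]; omega) (ih _ (by omega))
    rwa [gen_mul_cancel_left] at this

/-! ### Left multiplication in the rescaled basis -/

variable {θ : ℝ} (hθ : 0 < θ)

theorem heckeTtilde_apply (w : DihedralGroup n) :
    heckeTtilde n θ hθ w = θ ^ length n w • heckeT n θ⁻¹ w := by
  rw [heckeTtilde, Module.Basis.isUnitSMul_apply, inv_pow, inv_inv]

theorem heckeTtilde_one : heckeTtilde n θ hθ 1 = 1 := by
  rw [heckeTtilde_apply, heckeT_one, length_one, pow_zero, one_smul]

theorem length_gen (i : Fin 2) : length n (gen n i) = 1 := by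
  have h1 := length_gen_mul_le i (1 : DihedralGroup n)
  have h2 := length_gen_mul_ne i (1 : DihedralGroup n)
  rw [length_one, mul_one] at h1 h2
  omega

/-- Multiplication by a generator changes the length by one. -/
theorem length_gen_mul (i : Fin 2) (w : DihedralGroup n) :
    length n (gen n i * w) = length n w + 1 ∨ length n w = length n (gen n i * w) + 1 := by
  have h1 := length_gen_mul_le i w
  have h2 := length_gen_mul_ne i w
  have h3 := length_gen_mul_le i (gen n i * w)
  rw [gen_mul_cancel_left] at h3
  omega

/-- In the rescaled basis the structure constants are exactly the Metropolis transition
probabilities. -/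
theorem heckeTtilde_gen_mul (i : Fin 2) (w : DihedralGroup n) :
    heckeTtilde n θ hθ (gen n i) * heckeTtilde n θ hθ w =
      if length n w < length n (gen n i * w) then heckeTtilde n θ hθ (gen n i * w)
      else (1 - θ) • heckeTtilde n θ hθ w + θ • heckeTtilde n θ hθ (gen n i * w) := by
  have h := length_gen_mul i w
  simp only [heckeTtilde_apply, smul_mul_smul_comm, heckeT_gen_mul, length_gen, pow_one]
  split_ifs with h1
  · rw [show length n (gen n i * w) = length n w + 1 by omega, pow_succ']
  · rw [show length n w = length n (gen n i * w) + 1 by omega, smul_add, smul_smul, smul_smul,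
      smul_smul, smul_smul, pow_succ]
    congr 2 <;> field_simp

theorem heckeTtilde_altProd (m : ℕ) (hm : m ≤ n) (i j : Fin 2) (hij : i ≠ j) :
    altProd (heckeTtilde n θ hθ (gen n i)) (heckeTtilde n θ hθ (gen n j)) m =
      heckeTtilde n θ hθ (altProd (gen n i) (gen n j) m) := by
  induction m generalizing i j with
  | zero => simp [altProd, heckeTtilde_one]
  | succ m ih =>
    have h1 := length_altProd (m + 1) hm i j hij
    have h2 := length_altProd m (Nat.le_of_succ_le hm) j i hij.symm
    rw [altProd] at h1
    rw [altProd, altProd, ih (by omega) j i hij.symm, heckeTtilde_gen_mul, if_pos (by omega)]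

theorem altProd_heckeTtilde_eq_longest (i j : Fin 2) (hij : i ≠ j) :
    altProd (heckeTtilde n θ hθ (gen n i)) (heckeTtilde n θ hθ (gen n j)) n =
      heckeTtilde n θ hθ (longest n) := by
  rw [heckeTtilde_altProd hθ n le_rfl i j hij, altProd_gen_eq_longest i j hij]

theorem heckeTtilde_longest_sq (i j : Fin 2) (hij : i ≠ j) :
    heckeTtilde n θ hθ (longest n) ^ 2 =
      altProd (heckeTtilde n θ hθ (gen n i)) (heckeTtilde n θ hθ (gen n j)) (2 * n) := by
  rw [← altProd_mul_self, altProd_heckeTtilde_eq_longest hθ i j hij, sq]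
  rw [altProd_heckeTtilde_eq_longest hθ i j hij, altProd_heckeTtilde_eq_longest hθ j i hij.symm]

/-- `T̃_{w₀}²` commutes with the basis elements. -/
theorem heckeTtilde_longest_sq_mul_comm (x : DihedralGroup n) :
    heckeTtilde n θ hθ (longest n) ^ 2 * heckeTtilde n θ hθ x =
      heckeTtilde n θ hθ x * heckeTtilde n θ hθ (longest n) ^ 2 := by
  have hgen : ∀ i j : Fin 2, i ≠ j →
      heckeTtilde n θ hθ (longest n) ^ 2 * heckeTtilde n θ hθ (gen n i) =
        heckeTtilde n θ hθ (gen n i) * heckeTtilde n θ hθ (longest n) ^ 2 := by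
    intro i j hij
    conv_lhs => rw [heckeTtilde_longest_sq hθ i j hij, altProd_two_mul]
    conv_rhs => rw [heckeTtilde_longest_sq hθ j i hij.symm, altProd_two_mul]
    -- With a = T̃_i and b = T̃_j, this is a(ba)ⁿ = (ab)ⁿa, where (ab)ⁿ and (ba)ⁿ are both T̃_{w₀}².
    exact ((SemiconjBy.pow_right (show SemiconjBy (heckeTtilde n θ hθ (gen n i))
      (heckeTtilde n θ hθ (gen n j) * heckeTtilde n θ hθ (gen n i))
      (heckeTtilde n θ hθ (gen n i) * heckeTtilde n θ hθ (gen n j)) from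
        (mul_assoc _ _ _).symm) n).eq).symm
  have hgen' : ∀ i : Fin 2, Commute (heckeTtilde n θ hθ (longest n) ^ 2)
      (heckeTtilde n θ hθ (gen n i)) := fun i => hgen i (1 - i) (by fin_cases i <;> decide)
  induction x using length_induction with
  | one => rw [heckeTtilde_one, mul_one, one_mul]
  | step i w h ih =>
    have e := heckeTtilde_gen_mul hθ i w
    rw [if_pos h] at e
    rw [← e]
    exact (hgen' i).mul_right ih

/-! ### The chain as a product of Metropolis steps -/

theorem leftMulMatrix_one : leftMulMatrix n θ hθ 1 = 1 := by
  ext x y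
  rw [leftMulMatrix, Matrix.of_apply, one_mul, Module.Basis.repr_self, Finsupp.single_apply,
    Matrix.one_apply]

/-- The order is reversed because rows are indexed by the argument, so matrices act on row vectors.
-/
theorem leftMulMatrix_mul (g h : Hecke n θ⁻¹) :
    leftMulMatrix n θ hθ (g * h) = leftMulMatrix n θ hθ h * leftMulMatrix n θ hθ g := by
  ext x y
  simp only [leftMulMatrix, Matrix.of_apply, Matrix.mul_apply]
  conv_lhs => rw [mul_assoc, ← (heckeTtilde n θ hθ).sum_repr (h * heckeTtilde n θ hθ x)]
  simp only [Finset.mul_sum, mul_smul_comm, map_sum, map_smul, Finsupp.coe_finsetSum,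
    Finset.sum_apply, Finsupp.smul_apply, smul_eq_mul]

theorem leftMulMatrix_pow (g : Hecke n θ⁻¹) (m : ℕ) :
    leftMulMatrix n θ hθ (g ^ m) = leftMulMatrix n θ hθ g ^ m := by
  induction m with
  | zero => rw [pow_zero, pow_zero, leftMulMatrix_one]
  | succ m ih => rw [pow_succ, leftMulMatrix_mul, ih, pow_succ']

theorem leftMulMatrix_gen (i : Fin 2) :
    leftMulMatrix n θ hθ (heckeTtilde n θ hθ (gen n i)) = metropolis n θ i := by
  ext x y
  have h := length_gen_mul_ne i x
  have hne : gen n i * x ≠ x := fun h' => h (by rw [h'])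
  simp only [leftMulMatrix, metropolis, Matrix.of_apply, heckeTtilde_gen_mul]
  split_ifs <;> simp_all [eq_comm]

theorem scan_eq_altProd :
    scan n θ hθ = altProd (metropolis n θ 0) (metropolis n θ 1) (2 * n) := by
  -- The word starting with s₂ is used, so that the order reversal yields a product starting with
  -- K₁.
  rw [scan, heckeTtilde_longest_sq hθ 1 0 (by decide), altProd_two_mul, leftMulMatrix_pow,
    leftMulMatrix_mul, leftMulMatrix_gen, leftMulMatrix_gen, altProd_two_mul]

/-! ### The expansion of `T̃_{w₀}²` -/

/-- Left multiplication by a generator, in coordinates. -/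
theorem heckeTtilde_gen_mul_sum (i : Fin 2) (f : DihedralGroup n → ℝ) :
    heckeTtilde n θ hθ (gen n i) * ∑ w, f w • heckeTtilde n θ hθ w =
      ∑ w, (if length n (gen n i * w) < length n w then f (gen n i * w) + (1 - θ) * f w
        else θ * f (gen n i * w)) • heckeTtilde n θ hθ w := by
  let σ : Equiv.Perm (DihedralGroup n) := Equiv.mulLeft (gen n i)
  have h1 : ∀ w, f w • (heckeTtilde n θ hθ (gen n i) * heckeTtilde n θ hθ w) =
      ((if length n (gen n i * w) < length n w then (1 - θ) * f w else 0) •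
        heckeTtilde n θ hθ w) +
      (if length n w < length n (gen n i * w) then f w else θ * f w) •
        heckeTtilde n θ hθ (gen n i * w) := by
    intro w
    have h := length_gen_mul_ne i w
    rw [heckeTtilde_gen_mul]
    split_ifs <;> first | omega | skip
    · rw [zero_smul, zero_add]
    · module
  simp only [Finset.mul_sum, mul_smul_comm, h1, Finset.sum_add_distrib]
  -- The part of the mass that moves is reindexed by the involution w ↦ s_i w.
  rw [← Equiv.sum_comp σ fun w => (if length n w < length n (gen n i * w) then f w else θ * f w) •
        heckeTtilde n θ hθ (gen n i * w), ← Finset.sum_add_distrib]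
  refine Finset.sum_congr rfl fun w _ => ?_
  have h := length_gen_mul_ne i w
  simp only [σ, Equiv.coe_mulLeft, gen_mul_cancel_left, ← add_smul]
  congr 1
  split_ifs <;> first | omega | ring

/-- `∑ θ^(n - ℓ(w)) T̃_w` is fixed by left multiplication by the generators. -/
theorem heckeTtilde_gen_mul_sum_pow (i : Fin 2) :
    heckeTtilde n θ hθ (gen n i) * ∑ w, θ ^ (n - length n w) • heckeTtilde n θ hθ w =
      ∑ w, θ ^ (n - length n w) • heckeTtilde n θ hθ w := by
  rw [heckeTtilde_gen_mul_sum]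
  refine Finset.sum_congr rfl fun w _ => ?_
  have h := length_gen_mul i w
  have h1 := length_le w
  have h2 := length_le (gen n i * w)
  congr 1
  split_ifs
  · rw [show n - length n (gen n i * w) = n - length n w + 1 by omega]; ring
  · rw [show n - length n w = n - length n (gen n i * w) + 1 by omega]; ring

/-- `∑ (-1)^ℓ(w) T̃_w` is multiplied by `-θ` under left multiplication by the generators. -/
theorem heckeTtilde_gen_mul_sum_sign (i : Fin 2) :
    heckeTtilde n θ hθ (gen n i) * ∑ w, (-1 : ℝ) ^ length n w • heckeTtilde n θ hθ w =
      (-θ) • ∑ w, (-1 : ℝ) ^ length n w • heckeTtilde n θ hθ w := by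
  rw [heckeTtilde_gen_mul_sum, Finset.smul_sum]
  refine Finset.sum_congr rfl fun w _ => ?_
  have h := length_gen_mul i w
  rw [smul_smul]
  congr 1
  split_ifs
  · rw [show length n w = length n (gen n i * w) + 1 by omega]; ring
  · rw [show length n (gen n i * w) = length n w + 1 by omega]; ring

theorem heckeTtilde_mul_sum_pow (x : DihedralGroup n) :
    heckeTtilde n θ hθ x * ∑ w, θ ^ (n - length n w) • heckeTtilde n θ hθ w =
      ∑ w, θ ^ (n - length n w) • heckeTtilde n θ hθ w := by
  induction x using length_induction with
  | one => rw [heckeTtilde_one, one_mul]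
  | step i w h ih =>
    have e := heckeTtilde_gen_mul hθ i w
    rw [if_pos h] at e
    rw [← e, mul_assoc, ih, heckeTtilde_gen_mul_sum_pow]

theorem heckeTtilde_mul_sum_sign (x : DihedralGroup n) :
    heckeTtilde n θ hθ x * ∑ w, (-1 : ℝ) ^ length n w • heckeTtilde n θ hθ w =
      (-θ) ^ length n x • ∑ w, (-1 : ℝ) ^ length n w • heckeTtilde n θ hθ w := by
  induction x using length_induction with
  | one => rw [heckeTtilde_one, one_mul, length_one, pow_zero, one_smul]
  | step i w h ih =>
    have e := heckeTtilde_gen_mul hθ i w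
    have hl := length_gen_mul i w
    rw [if_pos h] at e
    rw [← e, mul_assoc, ih, mul_smul_comm, heckeTtilde_gen_mul_sum_sign, smul_smul,
      show length n (gen n i * w) = length n w + 1 by omega, pow_succ]

/-- The coordinates of `T̃_a T̃_b ⋯ T̃_{w₀}` (`k` factors before `T̃_{w₀}`). The element `v` is
`w₀` shortened from the left by `k` letters. -/
noncomputable def partialCoeff (θ : ℝ) (k : ℕ) (v w : DihedralGroup n) : ℝ :=
  (if w = v then θ ^ k else 0) +
    if n - length n w ≤ k then
      (1 - θ) / (1 + θ) * θ ^ (n - length n w) * (1 - (-θ) ^ (k - (n - length n w)))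
    else 0

/-- In each length strictly between `0` and `n` the two elements have different left descents. -/
theorem eq_of_length_eq {i : Fin 2} {v w : DihedralGroup n} (h : length n v = length n w)
    (hv : length n (gen n i * v) < length n v) (hw : length n (gen n i * w) < length n w) :
    v = w := by
  apply pos_injective
  have h1 := pos_lt v
  have h2 := pos_lt w
  rw [length_gen_mul_lt_iff] at hv hw
  simp only [length_eq_cycDist, cycDist] at h
  generalize pos n v = a at *
  generalize pos n w = b at *
  generalize i.val = i' at *
  split_ifs at hv hw <;> omega

/-- At codimension m = n - ℓ(w), put d = k - m. Where s_i is an ascent of w, the step only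
multiplies by θ. Where it is a descent, the factor c_d = 1 - (-θ)^d must satisfy c_{d+2} =
(1-θ)c_{d+1} + θc_d, whose characteristic roots 1 and -θ are the eigenvalues of T̃_i. -/
theorem partialCoeff_succ {θ : ℝ} (hθ : 0 < θ) (i : Fin 2) {k : ℕ} {v : DihedralGroup n}
    (hv : length n v + k = n) (hlt : length n (gen n i * v) < length n v) (w : DihedralGroup n) :
    (if length n (gen n i * w) < length n w then
        partialCoeff θ k v (gen n i * w) + (1 - θ) * partialCoeff θ k v w
      else θ * partialCoeff θ k v (gen n i * w)) = partialCoeff θ (k + 1) (gen n i * v) w := by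
  have hθ1 : 1 + θ ≠ 0 := by linarith
  have hl := length_gen_mul i w
  have hw := length_le w
  have hsw := length_le (gen n i * w)
  have e1 : w = gen n i * v ↔ gen n i * w = v :=
    ⟨fun h => by rw [h, gen_mul_cancel_left], fun h => by rw [← h, gen_mul_cancel_left]⟩
  simp only [partialCoeff, e1]
  by_cases hd : length n (gen n i * w) < length n w
  · have h1 : gen n i * w ≠ v := by
      intro h
      rw [← h, gen_mul_cancel_left] at hlt
      omega
    have h2 : w = v ↔ length n w = length n v :=
      ⟨fun h => by rw [h], fun h => eq_of_length_eq h hd hlt⟩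
    rw [if_pos hd, if_neg h1, if_neg h1]
    simp only [h2]
    obtain ⟨m, hm⟩ : ∃ m, n - length n w = m := ⟨_, rfl⟩
    rw [show n - length n (gen n i * w) = m + 1 by omega, hm]
    rcases lt_trichotomy m k with h | h | h
    · obtain ⟨d, rfl⟩ : ∃ d, k = m + 1 + d := ⟨k - m - 1, by omega⟩
      rw [if_neg (show ¬ length n w = length n v by omega),
        if_pos (show m + 1 ≤ m + 1 + d by omega), if_pos (show m ≤ m + 1 + d by omega),
        if_pos (show m ≤ m + 1 + d + 1 by omega), show m + 1 + d - (m + 1) = d by omega, show m + 1 + d - m = d + 1 by omega,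
        show m + 1 + d + 1 - m = d + 2 by omega]
      ring
    -- Here w = v: the mass (1-θ)θᵏ left behind starts the recurrence, and c₁ = 1 + θ explains the
    -- denominator in `partialCoeff`.
    · subst h
      rw [if_pos (show length n w = length n v by omega), if_neg (show ¬ m + 1 ≤ m by omega),
        if_pos le_rfl, if_pos (show m ≤ m + 1 by omega), show m - m = 0 by omega, show m + 1 - m = 1 by omega]
      field_simp
      ring
    · rw [if_neg (show ¬ length n w = length n v by omega), if_neg (show ¬ m + 1 ≤ k by omega),
        if_neg (show ¬ m ≤ k by omega)]
      -- At m = k + 1 the cutoff is met, but the factor 1 - (-θ)⁰ vanishes.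
      by_cases hmk : m ≤ k + 1
      · rw [if_pos hmk, show m = k + 1 by omega, Nat.sub_self]
        ring
      · rw [if_neg hmk]
        ring
  · rw [if_neg hd]
    obtain ⟨m, hm⟩ : ∃ m, n - length n (gen n i * w) = m := ⟨_, rfl⟩
    rw [show n - length n w = m + 1 by omega, hm]
    by_cases h : m ≤ k
    · rw [if_pos h, if_pos (show m + 1 ≤ k + 1 by omega), show k + 1 - (m + 1) = k - m by omega]
      split_ifs <;> ring
    · rw [if_neg h, if_neg (show ¬ m + 1 ≤ k + 1 by omega)]
      split_ifs <;> ring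


/-- The walk starts at the antipode n, and the leftmost letter together with the parity of n + k
fixes its direction; after n upward steps, position 2n wraps around to 0. -/
theorem pos_altProd_mul_longest (k : ℕ) (hk : k ≤ n) (i j : Fin 2) (hij : i ≠ j) :
    pos n (altProd (gen n i) (gen n j) k * longest n) =
      if (n + i.val + k) % 2 = 0 then (if k = n then 0 else n + k) else n - k := by
  have hn : 0 < n := Nat.pos_of_ne_zero (NeZero.ne n)
  induction k generalizing i j with
  | zero =>
    rw [altProd, one_mul, pos_longest]
    split_ifs <;> omega
  | succ k ih =>
    have hv : i.val + j.val = 1 := by omega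
    have hs : ∀ c, c = (if (n + j.val + k) % 2 = 0 then (if k = n then 0 else n + k) else n - k) →
        stepPos n ((c + i.val) % 2 = 1) c =
          if (n + i.val + (k + 1)) % 2 = 0 then (if k + 1 = n then 0 else n + (k + 1))
          else n - (k + 1) := by
      intro c h
      simp only [stepPos]
      split_ifs at h ⊢ <;> omega
    rw [altProd, mul_assoc, pos_gen_mul]
    exact hs _ (ih (by omega) j i hij.symm)

theorem length_altProd_mul_longest (k : ℕ) (hk : k ≤ n) (i j : Fin 2) (hij : i ≠ j) :
    length n (altProd (gen n i) (gen n j) k * longest n) = n - k := by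
  rw [length_eq_cycDist, cycDist, pos_altProd_mul_longest k hk i j hij]
  split_ifs <;> omega

theorem altProd_mul_longest_eq_sum (k : ℕ) (hk : k ≤ n) (i j : Fin 2) (hij : i ≠ j) :
    altProd (heckeTtilde n θ hθ (gen n i)) (heckeTtilde n θ hθ (gen n j)) k *
        heckeTtilde n θ hθ (longest n) =
      ∑ w, partialCoeff θ k (altProd (gen n i) (gen n j) k * longest n) w •
        heckeTtilde n θ hθ w := by
  induction k generalizing i j with
  | zero =>
    have h : ∀ w : DihedralGroup n,
        partialCoeff θ 0 (longest n) w = if w = longest n then 1 else 0 := by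
      intro w
      simp only [partialCoeff, pow_zero, Nat.zero_sub, sub_self, mul_zero, ite_self, add_zero]
    simp only [altProd, one_mul, h, ite_smul, one_smul, zero_smul, Finset.sum_ite_eq',
      Finset.mem_univ, if_true]
  | succ k ih =>
    have h1 := length_altProd_mul_longest k (Nat.le_of_succ_le hk) j i hij.symm
    have h2 := length_altProd_mul_longest (k + 1) hk i j hij
    rw [altProd, mul_assoc] at h2
    rw [altProd, altProd, mul_assoc, mul_assoc, ih (Nat.le_of_succ_le hk) j i hij.symm,
      heckeTtilde_gen_mul_sum]
    exact Finset.sum_congr rfl fun w _ => by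
      rw [partialCoeff_succ hθ i (by omega) (by omega)]

/-- `T̃_{w₀}²` is a combination of `1` and of generators of the two one-dimensional ideals. -/
theorem heckeTtilde_longest_sq_eq :
    heckeTtilde n θ hθ (longest n) ^ 2 = θ ^ n • 1 +
      (((1 - θ ^ n) / ∑ w : DihedralGroup n, θ ^ length n w) •
        ∑ w, θ ^ (n - length n w) • heckeTtilde n θ hθ w +
      ((θ ^ (2 * n) - θ ^ n) / ∑ w : DihedralGroup n, θ ^ length n w) •
        ∑ w, (-1 : ℝ) ^ length n w • heckeTtilde n θ hθ w) := by
  have hv : altProd (gen n 0) (gen n 1) n * longest n = 1 := by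
    by_contra hne
    obtain ⟨i, hi⟩ := exists_cycDist_gen_mul _ hne
    have h := length_altProd_mul_longest n le_rfl 0 1 (by decide)
    rw [length_eq_cycDist] at h
    omega
  have h := altProd_mul_longest_eq_sum hθ n le_rfl 0 1 (by decide)
  rw [altProd_heckeTtilde_eq_longest hθ 0 1 (by decide), ← sq, hv] at h
  have h1 : (1 : Hecke n θ⁻¹) = ∑ w, (if w = 1 then (1 : ℝ) else 0) • heckeTtilde n θ hθ w := by
    simp [heckeTtilde_one]
  have hP := (sum_pow_length_pos (n := n) hθ).ne'
  have hθ1 : 1 + θ ≠ 0 := by linarith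
  -- Dividing by P instead of 1 + θ is the normalisation that later makes E and F idempotent.
  have hc : (1 - θ) / (1 + θ) = (1 - θ ^ n) / ∑ w : DihedralGroup n, θ ^ length n w := by
    rw [div_eq_div_iff hθ1 hP, one_sub_mul_sum_pow_length, mul_comm]
  have hc' : (θ ^ (2 * n) - θ ^ n) / ∑ w : DihedralGroup n, θ ^ length n w =
      -(θ ^ n * ((1 - θ) / (1 + θ))) := by
    rw [hc]
    ring
  rw [h, hc', ← hc, h1]
  simp only [Finset.smul_sum, smul_smul]
  rw [← Finset.sum_add_distrib, ← Finset.sum_add_distrib]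
  refine Finset.sum_congr rfl fun w _ => ?_
  have hw := length_le w
  rw [← add_smul, ← add_smul]
  congr 1
  -- At k = n no term is cut off, and θ^(n-ℓ)(1 - (-θ)^ℓ) splits into the coefficients of S and of
  -- θⁿA.
  rw [partialCoeff, if_pos (Nat.sub_le _ _), Nat.sub_sub_self hw, mul_ite, mul_one, mul_zero]
  have e : θ ^ n = θ ^ (n - length n w) * θ ^ length n w := by
    rw [← pow_add, Nat.sub_add_cancel hw]
  rw [neg_pow]
  linear_combination (1 - θ) / (1 + θ) * (-1) ^ length n w * e

/-! ### Entries of the scan matrix and of its powers -/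

theorem scan_apply (x y : DihedralGroup n) :
    scan n θ hθ x y = (if x = y then θ ^ n else 0) + (1 - θ ^ n) * stat n θ y +
      (θ ^ (2 * n) - θ ^ n) *
        ((-θ) ^ length n x * (-1) ^ length n y / ∑ w : DihedralGroup n, θ ^ length n w) := by
  -- Centrality puts T̃_x on the left, so that its action on S and A is already known.
  rw [scan, leftMulMatrix, Matrix.of_apply, heckeTtilde_longest_sq_mul_comm,
    heckeTtilde_longest_sq_eq, stat_eq hθ]
  rw [mul_add, mul_add, mul_smul_comm, mul_smul_comm, mul_smul_comm, heckeTtilde_mul_sum_pow,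
    heckeTtilde_mul_sum_sign, mul_one]
  simp only [map_add, map_smul, map_sum, Module.Basis.repr_self, Finsupp.add_apply,
    Finsupp.smul_apply, Finsupp.coe_finsetSum, Finset.sum_apply,
    Finsupp.single_apply, smul_eq_mul, mul_ite, mul_one, mul_zero, Finset.sum_ite_eq',
    Finset.mem_univ, if_true]
  ring

include hθ in
theorem sum_stat : ∑ y, stat n θ y = 1 := by
  simp only [stat_eq hθ]
  rw [← Finset.sum_div, sum_pow_sub_length, div_self (sum_pow_length_pos hθ).ne']

include hθ in
theorem stat_pos (y : DihedralGroup n) : 0 < stat n θ y := by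
  rw [stat_eq hθ]
  exact div_pos (pow_pos hθ _) (sum_pow_length_pos hθ)

include hθ in
/-- The density of the sign eigenfunction with respect to counting measure. -/
theorem stat_mul_sign (y : DihedralGroup n) :
    stat n θ y * (-θ) ^ length n y =
      θ ^ n * (-1) ^ length n y / ∑ w : DihedralGroup n, θ ^ length n w := by
  have e : θ ^ n = θ ^ (n - length n y) * θ ^ length n y := by
    rw [← pow_add, Nat.sub_add_cancel (length_le y)]
  rw [stat_eq hθ, e, neg_pow]
  ring

include hθ in
/-- The sign eigenfunction is orthogonal to the constants. -/
theorem sum_stat_mul_sign : ∑ y : DihedralGroup n, stat n θ y * (-θ) ^ length n y = 0 := by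
  simp only [stat_mul_sign hθ]
  rw [← Finset.sum_div, ← Finset.mul_sum, sum_neg_one_pow_length, mul_zero, zero_div]

omit [NeZero n] in
theorem sign_mul_sign (y : DihedralGroup n) :
    (-1 : ℝ) ^ length n y * (-θ) ^ length n y = θ ^ length n y := by
  rw [← mul_pow, neg_one_mul, neg_neg]

/-- Powers of a combination of two orthogonal idempotents and their complement. -/
theorem pow_eq_of_orthogonal_idempotents {A : Type*} [Ring A] [Algebra ℝ A] {E F : A}
    (hE : E * E = E) (hF : F * F = F) (hEF : E * F = 0) (hFE : F * E = 0) (a b : ℝ) (l : ℕ) :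
    (a • (1 : A) + (1 - a) • E + (b - a) • F) ^ l =
      a ^ l • (1 : A) + (1 - a ^ l) • E + (b ^ l - a ^ l) • F := by
  induction l with
  | zero => simp
  | succ l ih =>
    rw [pow_succ, ih]
    simp only [mul_add, add_mul, smul_mul_smul_comm, one_mul, mul_one, hE, hF, hEF, hFE, smul_zero]
    module

theorem scan_pow_apply (l : ℕ) (x y : DihedralGroup n) :
    (scan n θ hθ ^ l) x y = (if x = y then (θ ^ n) ^ l else 0) +
      (1 - (θ ^ n) ^ l) * stat n θ y +
      ((θ ^ (2 * n)) ^ l - (θ ^ n) ^ l) *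
        ((-θ) ^ length n x * (-1) ^ length n y / ∑ w : DihedralGroup n, θ ^ length n w) := by
  have hP := (sum_pow_length_pos (n := n) hθ).ne'
  let E : Matrix (DihedralGroup n) (DihedralGroup n) ℝ := Matrix.of fun _ y => stat n θ y
  -- The pairing of the two vectors is Σ (-1)^ℓ(-θ)^ℓ = P, hence the division by P.
  let F : Matrix (DihedralGroup n) (DihedralGroup n) ℝ := Matrix.of fun x y =>
    (-θ) ^ length n x * (-1) ^ length n y / ∑ w : DihedralGroup n, θ ^ length n w
  have hE : E * E = E := by
    ext x y
    simp only [E, Matrix.mul_apply, Matrix.of_apply]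
    rw [← Finset.sum_mul, sum_stat hθ, one_mul]
  have hF : F * F = F := by
    ext x y
    simp only [F, Matrix.mul_apply, Matrix.of_apply]
    rw [Finset.sum_congr rfl fun z _ => show _ = (-θ) ^ length n x * (-1) ^ length n y /
      (∑ w : DihedralGroup n, θ ^ length n w) ^ 2 * θ ^ length n z by
        linear_combination (-θ) ^ length n x * (-1) ^ length n y /
          (∑ w : DihedralGroup n, θ ^ length n w) ^ 2 * sign_mul_sign z]
    rw [← Finset.mul_sum]
    field_simp
  have hEF : E * F = 0 := by
    ext x y
    simp only [E, F, Matrix.mul_apply, Matrix.of_apply, Matrix.zero_apply, mul_div_assoc,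
      ← mul_assoc]
    rw [← Finset.sum_mul, sum_stat_mul_sign hθ, zero_mul]
  have hFE : F * E = 0 := by
    ext x y
    simp only [E, F, Matrix.mul_apply, Matrix.of_apply, Matrix.zero_apply]
    rw [← Finset.sum_mul, ← Finset.sum_div, ← Finset.mul_sum, sum_neg_one_pow_length, mul_zero,
      zero_div, zero_mul]
  have hK : scan n θ hθ =
      θ ^ n • (1 : Matrix (DihedralGroup n) (DihedralGroup n) ℝ) + (1 - θ ^ n) • E +
        (θ ^ (2 * n) - θ ^ n) • F := by
    ext x y
    simp [scan_apply, E, F, Matrix.one_apply]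
  rw [hK, pow_eq_of_orthogonal_idempotents hE hF hEF hFE]
  simp [E, F, Matrix.one_apply]

/-! ### The L²(π) distances -/

/-- This is the spectral formula: φ = (-θ)^ℓ has squared norm θⁿ in L²(π), so it contributes θ^(4ln)
φ(x)²/θⁿ, and the θⁿ-eigenspace contributes θ^(2ln) times the remainder 1/π(x) - 1 - φ(x)²/θⁿ. -/
theorem distSq_scan (l : ℕ) (x : DihedralGroup n) :
    distSq n θ (scan n θ hθ) l x =
      ((θ ^ n) ^ l) ^ 2 * ((stat n θ x)⁻¹ - 1) +
        (((θ ^ (2 * n)) ^ l) ^ 2 - ((θ ^ n) ^ l) ^ 2) * ((θ ^ length n x) ^ 2 / θ ^ n) := by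
  have hP := (sum_pow_length_pos (n := n) hθ).ne'
  have hn := (pow_pos hθ n).ne'
  rw [distSq]
  simp only [scan_pow_apply]
  set P := ∑ w : DihedralGroup n, θ ^ length n w with hPdef
  set a := (θ ^ n) ^ l
  set b := (θ ^ (2 * n)) ^ l
  set f := (-θ) ^ length n x with hf
  have hff : f ^ 2 = (θ ^ length n x) ^ 2 := by
    rw [hf, ← pow_mul, ← pow_mul, mul_comm, pow_mul, pow_mul, neg_sq]
  have hg : ∀ y : DihedralGroup n,
      (-1 : ℝ) ^ length n y = stat n θ y * (-θ) ^ length n y * P / θ ^ n := by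
    intro y
    rw [stat_mul_sign hθ, ← hPdef]
    field_simp
  -- The square is sorted into a point mass at x and multiples of π, πφ and θ^ℓ, whose sums are 1, 0
  -- and P.
  have key : ∀ y, (((if x = y then a else 0) + (1 - a) * stat n θ y +
      (b - a) * (f * (-1) ^ length n y / P)) / stat n θ y - 1) ^ 2 * stat n θ y =
      (if x = y then a ^ 2 * (stat n θ x)⁻¹ - 2 * a ^ 2 + 2 * a * (b - a) * (f ^ 2 / θ ^ n)
        else 0) + a ^ 2 * stat n θ y +
      (- 2 * a * (b - a) * (f / θ ^ n)) * (stat n θ y * (-θ) ^ length n y) +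
      (b - a) ^ 2 * (f ^ 2 / θ ^ n) / P * θ ^ length n y := by
    intro y
    have hs := (stat_pos hθ y).ne'
    have hq : (b - a) ^ 2 * (f ^ 2 / θ ^ n) / P * θ ^ length n y =
        (b - a) ^ 2 * f ^ 2 / (θ ^ n) ^ 2 * (stat n θ y * ((-θ) ^ length n y) ^ 2) := by
      rw [← sign_mul_sign y, hg y]
      field_simp
    rw [hq, hg y]
    by_cases hxy : x = y
    · subst hxy
      rw [if_pos rfl, if_pos rfl, ← hf]
      field_simp
      ring
    · rw [if_neg hxy, if_neg hxy]
      field_simp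
      ring
  simp only [key, Finset.sum_add_distrib, Finset.sum_ite_eq, Finset.mem_univ, if_true,
    ← Finset.mul_sum, sum_stat hθ, sum_stat_mul_sign hθ, ← hPdef, hff]
  field_simp
  ring

theorem distSq_scan_one (l : ℕ) :
    distSq n θ (scan n θ hθ) l 1 =
      θ ^ ((4 * l - 1) * n : ℤ) +
        θ ^ ((2 * l - 1) * n : ℤ) *
          ((∑ i ∈ Finset.range 2, θ ^ i) * (∑ i ∈ Finset.range n, θ ^ i) - 1) -
        θ ^ (2 * l * n) := by
  have hn := (pow_pos hθ n).ne'
  -- The exponent is negative at l = 0, so the integer power is rewritten as a quotient of natural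
  -- powers.
  have e1 : θ ^ ((4 * l - 1) * n : ℤ) = ((θ ^ n) ^ l) ^ 4 / θ ^ n := by
    rw [show ((4 * l - 1) * n : ℤ) = ((n * l * 4 : ℕ) : ℤ) - (n : ℕ) by push_cast; ring,
      zpow_sub₀ hθ.ne', zpow_natCast, zpow_natCast, pow_mul, pow_mul]
  have e2 : θ ^ ((2 * l - 1) * n : ℤ) = ((θ ^ n) ^ l) ^ 2 / θ ^ n := by
    rw [show ((2 * l - 1) * n : ℤ) = ((n * l * 2 : ℕ) : ℤ) - (n : ℕ) by push_cast; ring,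
      zpow_sub₀ hθ.ne', zpow_natCast, zpow_natCast, pow_mul, pow_mul]
  rw [distSq_scan, stat_eq hθ, length_one, sum_pow_length, e1, e2, Nat.sub_zero, pow_zero]
  rw [show θ ^ (2 * n) = (θ ^ n) ^ 2 by ring, show θ ^ (2 * l * n) = ((θ ^ n) ^ l) ^ 2 by ring]
  generalize (∑ i ∈ Finset.range 2, θ ^ i) * (∑ i ∈ Finset.range n, θ ^ i) = P
  rw [inv_div]
  field_simp
  ring

/-- The average is tr(K^(2l)) - 1, the sum of λ^(2l) over the other eigenvalues; the proof sums
`distSq_scan` directly. -/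
theorem sum_stat_mul_distSq_scan (l : ℕ) :
    ∑ x, stat n θ x * distSq n θ (scan n θ hθ) l x =
      θ ^ (4 * l * n) + (2 * n - 2) * θ ^ (2 * l * n) := by
  have hn := (pow_pos hθ n).ne'
  have hP := (sum_pow_length_pos (n := n) hθ).ne'
  have key : ∀ x, stat n θ x * distSq n θ (scan n θ hθ) l x =
      ((θ ^ n) ^ l) ^ 2 - ((θ ^ n) ^ l) ^ 2 * stat n θ x +
        (((θ ^ (2 * n)) ^ l) ^ 2 - ((θ ^ n) ^ l) ^ 2) / (∑ w : DihedralGroup n, θ ^ length n w) *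
          θ ^ length n x := by
    intro x
    have hs := (stat_pos hθ x).ne'
    have h : stat n θ x * (θ ^ length n x) ^ 2 / θ ^ n =
        θ ^ length n x / ∑ w : DihedralGroup n, θ ^ length n w := by
      have e : θ ^ n = θ ^ (n - length n x) * θ ^ length n x := by
        rw [← pow_add, Nat.sub_add_cancel (length_le x)]
      have h1 := (pow_pos hθ (n - length n x)).ne'
      have h2 := (pow_pos hθ (length n x)).ne'
      rw [stat_eq hθ, e]
      field_simp
    rw [distSq_scan]
    linear_combination (((θ ^ (2 * n)) ^ l) ^ 2 - ((θ ^ n) ^ l) ^ 2) * h +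
      ((θ ^ n) ^ l) ^ 2 * mul_inv_cancel₀ hs
  simp only [key]
  rw [Finset.sum_add_distrib, Finset.sum_sub_distrib, ← Finset.mul_sum, ← Finset.mul_sum,
    sum_stat hθ, div_mul_cancel₀ _ hP, Finset.sum_const, Finset.card_univ, DihedralGroup.card,
    nsmul_eq_mul]
  push_cast
  ring

include hθ in
theorem distSq_nonneg (K : Matrix (DihedralGroup n) (DihedralGroup n) ℝ) (l : ℕ)
    (x : DihedralGroup n) : 0 ≤ distSq n θ K l x :=
  Finset.sum_nonneg fun y _ => mul_nonneg (sq_nonneg _) (stat_pos hθ y).le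

theorem distSq_scan_one_le (hθ1 : θ < 1) :
    distSq n θ (scan n θ hθ) 1 1 ≤ 2 * θ ^ (n + 1) / (1 - θ) := by
  have hu := pow_pos hθ n
  have hu1 : θ ^ n ≤ 1 := pow_le_one₀ hθ.le hθ1.le
  have h1 : 0 < 1 - θ := sub_pos.2 hθ1
  have hP := one_sub_mul_sum_pow_length (n := n) θ
  rw [distSq_scan, stat_eq hθ, length_one, inv_div, Nat.sub_zero, pow_zero, le_div_iff₀ h1,
    pow_one, pow_one, show θ ^ (2 * n) = (θ ^ n) ^ 2 by ring, pow_succ θ n]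
  generalize ∑ w : DihedralGroup n, θ ^ length n w = P at *
  generalize θ ^ n = u at *
  have e : (u ^ 2 * (P / u - 1) + ((u ^ 2) ^ 2 - u ^ 2) * (1 ^ 2 / u)) * (1 - θ) =
      u * ((1 - θ) * P) + u * (u ^ 2 - u - 1) * (1 - θ) := by
    field_simp
    ring
  rw [e, hP]
  have h2 : 0 ≤ u * (u * ((1 - u) * (1 - θ))) :=
    mul_nonneg hu.le (mul_nonneg hu.le (mul_nonneg (sub_nonneg.2 hu1) h1.le))
  have h3 : 0 ≤ u * (u * (1 + θ)) := by positivity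
  -- Exactly 2uθ with u = θⁿ, minus the two nonnegative terms `h3` and `h2`.
  linarith [show u * ((1 + θ) * (1 - u)) + u * (u ^ 2 - u - 1) * (1 - θ) =
    2 * (u * θ) - u * (u * (1 + θ)) - u * (u * ((1 - u) * (1 - θ))) by ring]

end DihedralScan

theorem theorem6p7 (θ : ℝ) (hθ : 0 < θ) (hθ1 : θ ≤ 1) :
    (∀ (n : ℕ) [NeZero n],
      -- the scan element is the alternating product with `2n` factors
      DihedralScan.heckeTtilde n θ hθ (DihedralScan.longest n) ^ 2 =
          DihedralScan.altProd (DihedralScan.heckeTtilde n θ hθ (DihedralScan.gen n 0))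
            (DihedralScan.heckeTtilde n θ hθ (DihedralScan.gen n 1)) (2 * n) ∧
      -- so one scan runs through `2n` Metropolis steps
      DihedralScan.scan n θ hθ =
          DihedralScan.altProd (DihedralScan.metropolis n θ 0)
            (DihedralScan.metropolis n θ 1) (2 * n) ∧
      ∀ l : ℕ,
        -- (a), with `(θᵏ - 1) / (θ - 1)` read as `1 + θ + ⋯ + θᵏ⁻¹`, and as printed for `θ < 1`
        (DihedralScan.distSq n θ (DihedralScan.scan n θ hθ) l 1 =
            θ ^ ((4 * l - 1) * n : ℤ) +
              θ ^ ((2 * l - 1) * n : ℤ) *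
                ((∑ i ∈ Finset.range 2, θ ^ i) * (∑ i ∈ Finset.range n, θ ^ i) - 1) -
              θ ^ (2 * l * n)) ∧
        (θ < 1 →
          DihedralScan.distSq n θ (DihedralScan.scan n θ hθ) l 1 =
            θ ^ ((4 * l - 1) * n : ℤ) +
              θ ^ ((2 * l - 1) * n : ℤ) *
                ((θ ^ 2 - 1) / (θ - 1) * ((θ ^ n - 1) / (θ - 1)) - 1) -
              θ ^ (2 * l * n)) ∧
        -- (b)
        ∑ x, DihedralScan.stat n θ x *
            DihedralScan.distSq n θ (DihedralScan.scan n θ hθ) l x =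
          θ ^ (4 * l * n) + (2 * n - 2) * θ ^ (2 * l * n)) ∧
    -- a single scan suffices
    (θ < 1 →
      (∀ (n : ℕ) [NeZero n],
        DihedralScan.distSq n θ (DihedralScan.scan n θ hθ) 1 1 ≤ 2 * θ ^ (n + 1) / (1 - θ)) ∧
      Filter.Tendsto
        (fun m : ℕ => DihedralScan.distSq (m + 1) θ (DihedralScan.scan (m + 1) θ hθ) 1 1)
        Filter.atTop (nhds 0)) := by
  refine ⟨fun n _ => ⟨DihedralScan.heckeTtilde_longest_sq hθ 0 1 (by decide),
    DihedralScan.scan_eq_altProd hθ, fun l => ⟨DihedralScan.distSq_scan_one hθ l, fun h => ?_,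
      DihedralScan.sum_stat_mul_distSq_scan hθ l⟩⟩,
    fun h => ⟨fun n _ => DihedralScan.distSq_scan_one_le hθ h, ?_⟩⟩
  · rw [DihedralScan.distSq_scan_one hθ l, geom_sum_eq h.ne, geom_sum_eq h.ne]
  -- The bound has exponent n + 1 and here n = m + 1, hence the shift by 2.
  · have ht : Filter.Tendsto (fun m : ℕ => 2 * θ ^ (m + 1 + 1) / (1 - θ)) Filter.atTop
        (nhds (2 * 0 / (1 - θ))) :=
      (((Filter.tendsto_add_atTop_iff_nat 2).2
        (tendsto_pow_atTop_nhds_zero_of_lt_one hθ.le h)).const_mul 2).div_const _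
    rw [mul_zero, zero_div] at ht
    exact squeeze_zero (fun m => DihedralScan.distSq_nonneg hθ _ _ _)
      (fun m => DihedralScan.distSq_scan_one_le hθ h) ht
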